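/- Let $A$ be an alphabet with exactly three letters and let $\omega=\omega_0\omega_1\omega_2\cdots$ be a right infinite word over $A$ in which each of the three letters occurs. A factor of $\omega$ of length $n$ is a finite word $\omega_i\omega_{i+1}\cdots\omega_{i+n-1}$ with $i\ge 0$. For a finite word $u$ and a letter $a$, let $|u|_a$ be the number of occurrences of $a$ in $u$. Assume that $\omega$ is aperiodic, that is, not ultimately periodic (there are no $N\ge 0$ and $p\ge 1$ with $\omega_{i+p}=\omega_i$ for all $i\ge N$), and balanced, that is, $\bigl||U|_a-|V|_a\bigr|\le 1$ for every letter $a\in A$ and all factors $U,V$ of $\omega$ of equal length. Then for every $n\ge 1$ the abelian complexity $\rho^{\mathrm{ab}}_\omega(n)$ equals $3$, where $\rho^{\mathrm{ab}}_\omega(n)$ is the number of classes of factors of $\omega$ of length $n$ under abelian equivalence: $u\sim_{\mathrm{ab}}v$ if and only if $|u|_a=|v|_a$ for all $a\in A$. -/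

import Mathlib

namespace AbelianWords

/-- The finite word `ω_i ω_{i+1} ⋯ ω_{i+n-1}` read in the right infinite word `ω`. -/
def window {A : Type*} (ω : ℕ → A) (i n : ℕ) : List A :=
  (List.range n).map (fun j => ω (i + j))

/-- The set of all factors of length `n` of the right infinite word `ω`. -/
def factors {A : Type*} (ω : ℕ → A) (n : ℕ) : Set (List A) :=
  {u | ∃ i : ℕ, u = window ω i n}

/-- Abelian equivalence of finite words: every letter occurs equally often in both. -/
def AbelianEquiv {A : Type*} [DecidableEq A] (u v : List A) : Prop :=
  ∀ a : A, u.count a = v.count a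

/-- Abelian equivalence restricted to the factors of length `n` of `ω`. -/
def factorSetoid {A : Type*} [DecidableEq A] (ω : ℕ → A) (n : ℕ) : Setoid (factors ω n) where
  r u v := AbelianEquiv (u : List A) (v : List A)
  iseqv :=
    { refl := fun _ _ => rfl
      symm := fun h a => (h a).symm
      trans := fun h k a => (h a).trans (k a) }

/-- The abelian complexity of `ω`: the number of abelian equivalence classes
of factors of length `n`. -/
noncomputable def abelianComplexity {A : Type*} [DecidableEq A] (ω : ℕ → A) (n : ℕ) : ℕ :=
  Nat.card (Quotient (factorSetoid ω n))

/-- `ω` is `C`-balanced: for any two factors of equal length and any letter, the numbers of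
occurrences of that letter in the two factors differ by at most `C`. -/
def IsCBalanced {A : Type*} [DecidableEq A] (C : ℕ) (ω : ℕ → A) : Prop :=
  ∀ n : ℕ, ∀ U ∈ factors ω n, ∀ V ∈ factors ω n, ∀ a : A,
    |(U.count a : ℤ) - (V.count a : ℤ)| ≤ (C : ℤ)

/-- `ω` is balanced if it is `1`-balanced. -/
def IsBalanced {A : Type*} [DecidableEq A] (ω : ℕ → A) : Prop :=
  IsCBalanced 1 ω

/-- `ω` is ultimately periodic, i.e. of the form `u v v v ⋯` with `v` nonempty. -/
def IsUltimatelyPeriodic {A : Type*} (ω : ℕ → A) : Prop :=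
  ∃ N p : ℕ, 0 < p ∧ ∀ i : ℕ, N ≤ i → ω (i + p) = ω i

/-- `ω` is aperiodic if it is not ultimately periodic. -/
def IsAperiodic {A : Type*} (ω : ℕ → A) : Prop :=
  ¬ IsUltimatelyPeriodic ω

end AbelianWords

namespace AbelianWords

open Finset

/-! For fixed `n`, balance confines each letter count to two consecutive values. If all three counts
really vary, subtracting the minima leaves 0/1 vectors of constant sum 1 or 2, hence exactly the
three unit vectors or their three complements (`ncard_range_eq_three`).

No count can be constant (`exists_count_window_ne`). Otherwise the positions of some letter `z` are
`n`-periodic, so `z` fills an arithmetic progression that all other letters avoid. A balanced letter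
of irrational frequency meets every progression, by density of multiples modulo 1
(`not_irrational_slope`). The other letters thus have rational frequency, and balance makes their
positions ultimately periodic (`BalancedSums.exists_eventually_const`). Then so is the word, against
aperiodicity. -/

/-! ### Slopes of balanced integer sequences -/

/-- All increments of `S` over steps of equal length differ by at most one. -/
def BalancedSums (S : ℕ → ℤ) : Prop :=
  ∀ i j n : ℕ, S (i + n) - S i ≤ S (j + n) - S j + 1

theorem BalancedSums.mul_bounds {S : ℕ → ℤ} (hS : BalancedSums S) (i j n m : ℕ) :
    m * (S (i + n) - S i - 1) ≤ S (j + m * n) - S j ∧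
      S (j + m * n) - S j ≤ m * (S (i + n) - S i + 1) := by
  induction m with
  | zero => simp
  | succ m ih =>
    have h1 := hS (j + m * n) i n
    have h2 := hS i (j + m * n) n
    have e : j + (m + 1) * n = j + m * n + n := by ring
    rw [e]
    push_cast
    constructor <;> linarith [ih.1, ih.2]

/-- Cutting a block of length `n * m` in two ways puts every lower quotient below every upper one;
the slope is the supremum of the lower ones. -/
theorem BalancedSums.exists_slope {S : ℕ → ℤ} (hS : BalancedSums S) :
    ∃ α : ℝ, ∀ i n : ℕ, |(S (i + n) : ℝ) - S i - n * α| ≤ 1 := by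
  have key : ∀ i j n m : ℕ, 0 < n → 0 < m →
      ((S (i + n) : ℝ) - S i - 1) / n ≤ ((S (j + m) : ℝ) - S j + 1) / m := by
    intro i j n m hn hm
    have h1 := (hS.mul_bounds i j n m).1
    have h2 := (hS.mul_bounds j j m n).2
    rw [mul_comm n m] at h2
    have h3 := h1.trans h2
    rw [div_le_div_iff₀ (by positivity) (by positivity)]
    have h4 : ((m * (S (i + n) - S i - 1) : ℤ) : ℝ) ≤ ((n * (S (j + m) - S j + 1) : ℤ) : ℝ) := by
      exact_mod_cast h3
    push_cast at h4
    linarith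
  let T : Set ℝ := {x | ∃ i n : ℕ, 0 < n ∧ x = ((S (i + n) : ℝ) - S i - 1) / n}
  have hne : T.Nonempty := ⟨_, 0, 1, one_pos, rfl⟩
  have hbdd : BddAbove T := ⟨((S (0 + 1) : ℝ) - S 0 + 1) / (1 : ℕ), by
    rintro x ⟨i, n, hn, rfl⟩
    exact key i 0 n 1 hn one_pos⟩
  refine ⟨sSup T, fun i n => ?_⟩
  rcases Nat.eq_zero_or_pos n with rfl | hn
  · simp
  have hn' : (0 : ℝ) < n := by exact_mod_cast hn
  have lo : ((S (i + n) : ℝ) - S i - 1) / n ≤ sSup T := le_csSup hbdd ⟨i, n, hn, rfl⟩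
  have hi : sSup T ≤ ((S (i + n) : ℝ) - S i + 1) / n := csSup_le hne (by
    rintro x ⟨j, m, hm, rfl⟩
    exact key j i m n hm hn)
  rw [div_le_iff₀ hn'] at lo
  rw [le_div_iff₀ hn'] at hi
  rw [abs_le]
  constructor <;> linarith

theorem exists_nsmul_add_int_mem_Ioo {θ : ℝ} (hθ : Irrational θ) {a b : ℝ} (hab : a < b) :
    ∃ (k : ℕ) (m : ℤ), k * θ + m ∈ Set.Ioo a b := by
  have hd : DenseRange (· • (θ : AddCircle (1 : ℝ)) : ℕ → AddCircle (1 : ℝ)) := by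
    rw [← denseRange_zsmul_iff_nsmul, AddCircle.denseRange_zsmul_coe_iff]
    simpa using hθ
  have ho : IsOpen ((fun x : ℝ => (x : AddCircle (1 : ℝ))) '' Set.Ioo a b) :=
    QuotientAddGroup.isOpenMap_coe _ isOpen_Ioo
  obtain ⟨k, x, hx, hk⟩ := hd.exists_mem_open ho ((Set.nonempty_Ioo.2 hab).image _)
  have hk' : ((x : ℝ) : AddCircle (1 : ℝ)) = ((k * θ : ℝ) : AddCircle (1 : ℝ)) := by
    rw [← nsmul_eq_mul, AddCircle.coe_nsmul]
    exact hk
  rw [← sub_eq_zero, ← AddCircle.coe_sub, AddCircle.coe_eq_zero_iff] at hk'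
  obtain ⟨m, hm⟩ := hk'
  refine ⟨k, m, ?_⟩
  rw [zsmul_eq_mul, mul_one] at hm
  rwa [hm, add_sub_cancel]

theorem eventually_zero_of_sum_le {e : ℕ → ℤ} (he : ∀ n, 0 ≤ e n) {B : ℤ}
    (hB : ∀ N, ∑ n ∈ range N, e n ≤ B) : ∃ N, ∀ n, N ≤ n → e n = 0 := by
  have hs : Set.Finite (Set.range fun N => ∑ n ∈ range N, e n) :=
    (Set.finite_Icc 0 B).subset (by
      rintro _ ⟨N, rfl⟩
      exact ⟨sum_nonneg fun n _ => he n, hB N⟩)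
  obtain ⟨_, ⟨N, rfl⟩, hN⟩ := hs.exists_maximal (Set.range_nonempty _)
  refine ⟨N, fun n hn => le_antisymm ?_ (he n)⟩
  have h1 : ∑ i ∈ range N, e i ≤ ∑ i ∈ range n, e i :=
    sum_le_sum_of_subset_of_nonneg (range_mono hn) fun i _ _ => he i
  have h2 : ∑ i ∈ range (n + 1), e i ≤ ∑ i ∈ range N, e i :=
    hN ⟨n + 1, rfl⟩ (h1.trans (by
      show ∑ i ∈ range n, e i ≤ ∑ i ∈ range (n + 1), e i
      rw [sum_range_succ]; linarith [he n]))
  rw [sum_range_succ] at h2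
  linarith

/-- Trades `N` terms for `q`, giving bounds independent of `N`. -/
theorem sum_range_shift_sub (D : ℕ → ℤ) (q N : ℕ) :
    ∑ n ∈ range N, (D (n + q) - D n) = ∑ j ∈ range q, (D (N + j) - D j) := by
  induction N with
  | zero => simp
  | succ N ih =>
    have h := sum_range_succ' (fun j => D (N + j)) q
    rw [sum_range_succ] at h
    rw [sum_range_succ, ih, sum_sub_distrib, sum_sub_distrib]
    have e : ∀ j, N + 1 + j = N + (j + 1) := fun j => by ring
    simp only [e]
    simp only [add_zero] at h
    rw [add_comm N q] at h ⊢
    linarith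

theorem BalancedSums.exists_eventually_const {S : ℕ → ℤ} (hS : BalancedSums S) {q : ℕ} {p : ℤ}
    (hq : 0 < q) (h : ∀ i n : ℕ, |(q : ℤ) * (S (i + n) - S i) - n * p| ≤ q) :
    ∃ N, ∀ i, N ≤ i → S (i + q) - S i = p := by
  have hq' : (0 : ℤ) < q := by exact_mod_cast hq
  have hone : ∀ n, |S (n + q) - S n - p| ≤ 1 := fun n => by
    have h1 := h n q
    rw [← mul_sub, abs_mul, abs_of_pos hq'] at h1
    nlinarith
  let D : ℕ → ℤ := fun n => q * S n - n * p
  have hD : ∀ n j, |D (n + j) - D n| ≤ q := fun n j => by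
    convert h n j using 2
    simp only [D]; push_cast; ring
  have hDq : ∀ n, D (n + q) - D n = q * (S (n + q) - S n - p) := fun n => by
    simp only [D]; push_cast; ring
  have hsum : ∀ N, |∑ n ∈ range N, (D (n + q) - D n)| ≤ q * q := fun N => by
    rw [sum_range_shift_sub]
    refine (abs_sum_le_sum_abs _ _).trans ?_
    have : ∑ j ∈ range q, |D (N + j) - D j| ≤ ∑ j ∈ range q, (q : ℤ) :=
      sum_le_sum fun j _ => by rw [add_comm N j]; exact hD j N
    simpa using this
  -- By balance and integrality, one negative excess forces all to be at most 0. So the excesses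
  -- share a sign, and their bounded partial sums make them eventually vanish.
  by_cases hneg : ∃ m, S (m + q) - S m - p < 0
  · obtain ⟨m, hm⟩ := hneg
    have hle : ∀ n, 0 ≤ -(D (n + q) - D n) := fun n => by
      have := hS n m q
      rw [hDq]
      nlinarith
    obtain ⟨N, hN⟩ := eventually_zero_of_sum_le hle (B := q * q) fun N => by
      rw [sum_neg_distrib]; exact (neg_le_abs _).trans (hsum N)
    refine ⟨N, fun i hi => ?_⟩
    have := hN i hi
    rw [hDq, neg_eq_zero] at this
    rcases mul_eq_zero.1 this with h0 | h0 <;> linarith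
  · push Not at hneg
    obtain ⟨N, hN⟩ := eventually_zero_of_sum_le (e := fun n => D (n + q) - D n)
      (fun n => by show 0 ≤ D (n + q) - D n; rw [hDq]; exact mul_nonneg hq'.le (hneg n)) (B := q * q)
      fun N => (le_abs_self _).trans (hsum N)
    refine ⟨N, fun i hi => ?_⟩
    have := hN i hi
    rw [hDq] at this
    rcases mul_eq_zero.1 this with h0 | h0 <;> linarith

/-- If `S` has irrational slope, it is not stationary along an arithmetic progression. -/
theorem not_irrational_slope {S : ℕ → ℤ} {α : ℝ}
    (hmono : ∀ n, S n ≤ S (n + 1))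
    (hα : ∀ i n : ℕ, |(S (i + n) : ℝ) - S i - n * α| ≤ 1) {r q : ℕ} (hq : 0 < q)
    (hap : ∀ k, S (r + k * q + 1) = S (r + k * q)) : ¬ Irrational α := by
  intro hirr
  have hpos : 0 < α := by
    refine lt_of_le_of_ne ?_ hirr.ne_zero.symm
    by_contra! hneg
    obtain ⟨n, hn⟩ := exists_nat_gt (1 / -α)
    rw [div_lt_iff₀ (by linarith)] at hn
    have h1 := (abs_le.1 (hα 0 n)).2
    have h2 : (S 0 : ℝ) ≤ S (0 + n) := by
      exact_mod_cast monotone_nat_of_le_succ hmono (Nat.zero_le _)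
    linarith
  let D : ℕ → ℝ := fun n => S n - n * α
  have hD : ∀ i j, D i ≤ D j + 1 := fun i j => by
    rcases le_total i j with h | h
    · obtain ⟨n, rfl⟩ := Nat.exists_eq_add_of_le h
      have := (abs_le.1 (hα i n)).1
      simp only [D]; push_cast; linarith
    · obtain ⟨n, rfl⟩ := Nat.exists_eq_add_of_le h
      have := (abs_le.1 (hα j n)).2
      simp only [D]; push_cast; linarith
  have hbdd : BddBelow (Set.range D) := ⟨D 0 - 1, by
    rintro _ ⟨n, rfl⟩
    linarith [hD 0 n]⟩
  set c := ⨅ n, D n with hc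
  have hlow : ∀ n, c ≤ D n := fun n => ciInf_le hbdd n
  have hhigh : ∀ n, D n ≤ c + 1 := fun n => by
    have : D n - 1 ≤ c := le_ciInf fun j => by linarith [hD n j]
    linarith
  -- Where `S` stands still, `D` drops by `α` at the next step yet stays at least `c`.
  have hap' : ∀ k, c + α ≤ D (r + k * q) := fun k => by
    have h1 := hlow (r + k * q + 1)
    simp only [D] at h1 ⊢
    rw [hap k] at h1
    push_cast at h1 ⊢
    linarith
  have hirr' : Irrational (-(q * α)) := (hirr.natCast_mul hq.ne').neg
  -- On the progression `D` lies in `[c + α, c + 1]`, so modulo 1 it misses the gap `(c, c + α)`;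
  -- density puts some `m - (r + k * q) * α` in that gap.
  obtain ⟨k, m, h1, h2⟩ := exists_nsmul_add_int_mem_Ioo hirr'
    (a := c + r * α) (b := c + α + r * α) (by linarith)
  have h3 := hap' k
  have h4 := hhigh (r + k * q)
  simp only [D] at h3 h4
  push_cast at h3 h4
  have h5 : (m : ℝ) < S (r + k * q) := by linarith
  have h6 : (S (r + k * q) : ℝ) < m + 1 := by linarith
  norm_cast at h5 h6
  omega

theorem BalancedSums.eventually_const_of_stationary {S : ℕ → ℤ} (hS : BalancedSums S)
    (hmono : ∀ n, S n ≤ S (n + 1)) {r q : ℕ} (hq : 0 < q)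
    (hap : ∀ k, S (r + k * q + 1) = S (r + k * q)) :
    ∃ N m : ℕ, 0 < m ∧ ∃ p, ∀ i, N ≤ i → S (i + m) - S i = p := by
  obtain ⟨α, hα⟩ := hS.exists_slope
  have hrat := not_irrational_slope hmono hα hq hap
  simp only [Irrational, Set.mem_range, not_not] at hrat
  obtain ⟨x, rfl⟩ := hrat
  have hd : (0 : ℝ) < x.den := by exact_mod_cast x.den_pos
  obtain ⟨N, hN⟩ := hS.exists_eventually_const x.den_pos (p := x.num) fun i n => by
    have h1 := mul_le_mul_of_nonneg_left (hα i n) hd.le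
    rw [← abs_of_pos hd, ← abs_mul, abs_of_pos hd, mul_one] at h1
    have h2 : (x.den : ℝ) * x = x.num := by exact_mod_cast Rat.den_mul_eq_num x
    have h3 : (x.den : ℝ) * ((S (i + n) : ℝ) - S i - n * x)
        = ((x.den * (S (i + n) - S i) - n * x.num : ℤ) : ℝ) := by
      push_cast; rw [← h2]; ring
    rw [h3] at h1
    exact_mod_cast h1
  exact ⟨N, x.den, x.den_pos, _, hN⟩

/-! ### Letter counts in balanced words -/

section Words

variable {A : Type*} [DecidableEq A]

/-- The number of occurrences of `a` in the prefix of length `n` of `ω`. -/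
def prefixCount (ω : ℕ → A) (a : A) (n : ℕ) : ℤ :=
  ∑ j ∈ range n, if ω j = a then 1 else 0

theorem prefixCount_succ (ω : ℕ → A) (a : A) (n : ℕ) :
    prefixCount ω a (n + 1) = prefixCount ω a n + if ω n = a then 1 else 0 :=
  sum_range_succ _ _

theorem count_window (ω : ℕ → A) (a : A) (i n : ℕ) :
    ((window ω i n).count a : ℤ) = prefixCount ω a (i + n) - prefixCount ω a i := by
  induction n with
  | zero => simp [window]
  | succ n ih =>
    have : window ω i (n + 1) = window ω i n ++ [ω (i + n)] := by
      simp [window, List.range_succ]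
    rw [this, List.count_append, ← add_assoc, prefixCount_succ]
    push_cast
    rw [ih, List.count_singleton]
    by_cases h : ω (i + n) = a <;> simp only [h, beq_iff_eq, if_true, if_false, Nat.cast_one, Nat.cast_zero] <;> ring

theorem IsBalanced.abs_count_sub_le {ω : ℕ → A} (h : IsBalanced ω) (n i j : ℕ) (a : A) :
    |((window ω i n).count a : ℤ) - (window ω j n).count a| ≤ 1 := by
  simpa using h n _ ⟨i, rfl⟩ _ ⟨j, rfl⟩ a

theorem IsBalanced.balancedSums {ω : ℕ → A} (h : IsBalanced ω) (a : A) :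
    BalancedSums (prefixCount ω a) := fun i j n => by
  have := (abs_le.1 (h.abs_count_sub_le n i j a)).2
  rw [count_window, count_window] at this
  linarith

/-- Sliding the window one place drops `ω i` and gains `ω (i + m)`. -/
theorem eq_iff_of_prefixCount_const {ω : ℕ → A} {a : A} {N m : ℕ} {p : ℤ}
    (h : ∀ i, N ≤ i → prefixCount ω a (i + m) - prefixCount ω a i = p) {i : ℕ} (hi : N ≤ i) :
    ω (i + m) = a ↔ ω i = a := by
  have h1 := h i hi
  have h2 := h (i + 1) (by omega)
  rw [show i + 1 + m = i + m + 1 by ring, prefixCount_succ, prefixCount_succ] at h2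
  by_cases ha : ω (i + m) = a <;> by_cases hb : ω i = a <;> simp [ha, hb] at h2 ⊢ <;> omega

/-- In a balanced word, a letter that avoids an arithmetic progression has an ultimately periodic
set of positions. -/
theorem IsBalanced.eventually_periodic_of_avoids {ω : ℕ → A} (h : IsBalanced ω) {a : A} {r q : ℕ}
    (hq : 0 < q) (hap : ∀ k, ω (r + k * q) ≠ a) :
    ∃ N m : ℕ, 0 < m ∧ ∀ i, N ≤ i → (ω (i + m) = a ↔ ω i = a) := by
  obtain ⟨N, m, hm, p, hp⟩ := (h.balancedSums a).eventually_const_of_stationary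
    (fun n => by rw [prefixCount_succ]; split_ifs <;> simp) hq (r := r)
    (fun k => by rw [prefixCount_succ, if_neg (hap k), add_zero])
  exact ⟨N, m, hm, fun i hi => eq_iff_of_prefixCount_const hp hi⟩

theorem isUltimatelyPeriodic_of_forall_letter {A : Type*} [Finite A] {ω : ℕ → A}
    (h : ∀ a, ∃ N m : ℕ, 0 < m ∧ ∀ i, N ≤ i → (ω (i + m) = a ↔ ω i = a)) :
    IsUltimatelyPeriodic ω := by
  cases nonempty_fintype A
  choose N m hm hN using h
  refine ⟨∑ a, N a, ∏ a, m a, prod_pos fun a _ => hm a, fun i hi => ?_⟩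
  have mult : ∀ a k i, N a ≤ i → (ω (i + k * m a) = a ↔ ω i = a) := fun a k => by
    induction k with
    | zero => simp
    | succ k ih =>
      intro i hi
      rw [show i + (k + 1) * m a = i + k * m a + m a by ring, hN a _ (by omega), ih i hi]
  obtain ⟨k, hk⟩ : m (ω i) ∣ ∏ a, m a := dvd_prod_of_mem _ (mem_univ _)
  rw [hk, mul_comm]
  exact (mult (ω i) k i ((single_le_sum (fun _ _ => Nat.zero_le _) (mem_univ _)).trans hi)).2 rfl

/-- In an aperiodic balanced word in which every letter occurs, no letter occurs equally often in
all factors of a given positive length. -/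
theorem exists_count_window_ne [Finite A] {ω : ℕ → A} (hsurj : Function.Surjective ω)
    (haper : IsAperiodic ω) (hbal : IsBalanced ω) {n : ℕ} (hn : 0 < n) (z : A) :
    ∃ i j, ((window ω i n).count z : ℤ) ≠ (window ω j n).count z := by
  by_contra! hconst
  have hz : ∀ i, 0 ≤ i → (ω (i + n) = z ↔ ω i = z) := fun i hi =>
    eq_iff_of_prefixCount_const (N := 0) (p := (window ω 0 n).count z)
      (fun i _ => by rw [← count_window]; exact hconst i 0) hi
  obtain ⟨r, hr⟩ := hsurj z
  have hap : ∀ k, ω (r + k * n) = z := fun k => by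
    induction k with
    | zero => simpa using hr
    | succ k ih => rwa [show r + (k + 1) * n = r + k * n + n by ring, hz _ (Nat.zero_le _)]
  refine haper (isUltimatelyPeriodic_of_forall_letter fun a => ?_)
  by_cases ha : a = z
  · subst ha
    exact ⟨0, n, hn, hz⟩
  · exact hbal.eventually_periodic_of_avoids hn fun k hk => ha (hk ▸ hap k)

end Words

/-! ### Counting integer vectors -/

section Vectors

variable {ι A : Type*} [Fintype A] [DecidableEq A]

theorem range_eq_range_single {g : ι → A → ℤ} (h01 : ∀ i a, g i a = 0 ∨ g i a = 1)
    (hsum : ∀ i, ∑ a, g i a = 1) (hone : ∀ a, ∃ i, g i a = 1) :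
    Set.range g = Set.range fun a : A => (Pi.single a 1 : A → ℤ) := by
  have key : ∀ i a, g i a = 1 → g i = Pi.single a 1 := fun i a ha => by
    have h0 : ∑ b ∈ univ.erase a, g i b = 0 := by
      have := add_sum_erase univ (g i) (mem_univ a)
      rw [hsum, ha] at this
      linarith
    rw [sum_eq_zero_iff_of_nonneg
      fun b _ => by rcases h01 i b with h | h <;> simp [h]] at h0
    ext b
    by_cases hb : b = a
    · subst hb; simpa using ha
    · simpa [hb] using h0 b (by simp [hb])
  ext v
  constructor
  · rintro ⟨i, rfl⟩
    by_contra hcon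
    have hz : ∀ a, g i a = 0 := fun a =>
      (h01 i a).resolve_right fun ha => hcon ⟨a, (key i a ha).symm⟩
    simpa [hz] using hsum i
  · rintro ⟨a, rfl⟩
    obtain ⟨i, hi⟩ := hone a
    exact ⟨i, key i a hi⟩

theorem ncard_range_of_sum_eq_one {g : ι → A → ℤ} (h01 : ∀ i a, g i a = 0 ∨ g i a = 1)
    (hsum : ∀ i, ∑ a, g i a = 1) (hone : ∀ a, ∃ i, g i a = 1) :
    (Set.range g).ncard = Fintype.card A := by
  rw [range_eq_range_single h01 hsum hone, ← Set.image_univ, Set.ncard_image_of_injective,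
    Set.ncard_univ, Nat.card_eq_fintype_card]
  intro a b hab
  by_contra hne
  simpa [hne] using congrFun hab a

/-- Integer vectors with three coordinates and constant coordinate sum, each of whose coordinates
takes exactly two consecutive values, form a set of three elements. -/
theorem ncard_range_eq_three (hA : Fintype.card A = 3) {f : ι → A → ℤ} {s : ℤ}
    (hclose : ∀ i j a, |f i a - f j a| ≤ 1) (hne : ∀ a, ∃ i j, f i a ≠ f j a)
    (hsum : ∀ i, ∑ a, f i a = s) : (Set.range f).ncard = 3 := by
  have hmin : ∀ a, ∃ m, (∀ i, f i a - m = 0 ∨ f i a - m = 1) ∧ (∃ i, f i a - m = 0) ∧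
      ∃ i, f i a - m = 1 := fun a => by
    obtain ⟨i, j, hij⟩ : ∃ i j, f i a < f j a := by
      obtain ⟨i, j, hij⟩ := hne a
      rcases lt_or_gt_of_ne hij with h | h
      exacts [⟨i, j, h⟩, ⟨j, i, h⟩]
    have h1 := abs_le.1 (hclose j i a)
    refine ⟨f i a, fun k => ?_, ⟨i, by ring⟩, ⟨j, by omega⟩⟩
    have h2 := abs_le.1 (hclose k i a)
    have h3 := abs_le.1 (hclose k j a)
    omega
  choose m h01 hzero hone using hmin
  obtain ⟨t, ht⟩ : ∃ t, ∀ i, ∑ a, (f i a - m a) = t :=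
    ⟨s - ∑ a, m a, fun i => by rw [sum_sub_distrib, hsum]⟩
  have hcompl : ∀ i, ∑ a, (1 - (f i a - m a)) = 3 - t := fun i => by
    rw [sum_sub_distrib, ht]; simp [hA]
  obtain ⟨a₀⟩ : Nonempty A := Fintype.card_pos_iff.1 (by omega)
  -- Some coordinate attains 1, so `t > 0`; it also attains 0, so `t < 3`.
  have hpos : 0 < t := by
    obtain ⟨i, hi⟩ := hone a₀
    rw [← ht i]
    exact sum_pos' (fun a _ => by rcases h01 a i with h | h <;> omega)
      ⟨a₀, mem_univ _, by omega⟩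
  have hlt : 0 < 3 - t := by
    obtain ⟨i, hi⟩ := hzero a₀
    rw [← hcompl i]
    exact sum_pos' (fun a _ => by rcases h01 a i with h | h <;> omega)
      ⟨a₀, mem_univ _, by omega⟩
  obtain rfl | rfl : t = 1 ∨ t = 2 := by omega
  · rw [← hA, ← ncard_range_of_sum_eq_one (g := fun i a => f i a - m a)
      (fun i a => h01 a i) ht hone,
      show (fun i a => f i a - m a) = (fun v : A → ℤ => v - m) ∘ f from rfl, Set.range_comp]
    exact (Set.ncard_image_of_injective _ sub_left_injective).symm
  · rw [← hA, ← ncard_range_of_sum_eq_one (g := fun i a => 1 - (f i a - m a))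
      (fun i a => by rcases h01 a i with h | h <;> simp [h]) hcompl
      (fun a => by obtain ⟨i, hi⟩ := hzero a; exact ⟨i, by rw [hi]; rfl⟩),
      show (fun i a => 1 - (f i a - m a)) = (fun v : A → ℤ => 1 - (v - m)) ∘ f from rfl,
      Set.range_comp]
    exact (Set.ncard_image_of_injective _
      (sub_right_injective.comp sub_left_injective)).symm

end Vectors

/-! ### Abelian classes as count vectors -/

theorem abelianComplexity_eq_ncard {A : Type*} [DecidableEq A] (ω : ℕ → A) (n : ℕ) :
    abelianComplexity ω n =
      (Set.range fun (i : ℕ) (a : A) => ((window ω i n).count a : ℤ)).ncard := by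
  let φ : Quotient (factorSetoid ω n) → A → ℤ :=
    Quotient.lift (fun u a => ((u : List A).count a : ℤ)) fun u v h => by
      ext a
      exact_mod_cast h a
  have hφ : Function.Injective φ := by
    rintro ⟨u⟩ ⟨v⟩ h
    exact Quotient.sound fun a => Int.ofNat.inj (congrFun h a)
  have hr : Set.range φ = Set.range fun (i : ℕ) (a : A) => ((window ω i n).count a : ℤ) := by
    ext v
    constructor
    · rintro ⟨⟨u, i, rfl⟩, rfl⟩
      exact ⟨i, rfl⟩
    · rintro ⟨i, rfl⟩
      exact ⟨Quotient.mk _ ⟨_, i, rfl⟩, rfl⟩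
  rw [← hr, abelianComplexity, ← Set.image_univ, Set.ncard_image_of_injective _ hφ,
    Set.ncard_univ]

theorem sum_count_window {A : Type*} [Fintype A] [DecidableEq A] (ω : ℕ → A) (i n : ℕ) :
    ∑ a, ((window ω i n).count a : ℤ) = n := by
  have h := Multiset.sum_count_eq_card (s := (univ : Finset A)) (m := (window ω i n : Multiset A))
    fun a _ => mem_univ a
  simp only [Multiset.coe_count, Multiset.coe_card] at h
  rw [← Nat.cast_sum, h]
  simp [window]

end AbelianWords

theorem theorem5p1 {A : Type*} [Fintype A] [DecidableEq A] (hA : Fintype.card A = 3)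
    (ω : ℕ → A) (hletters : Function.Surjective ω)
    (haper : AbelianWords.IsAperiodic ω) (hbal : AbelianWords.IsBalanced ω) :
    ∀ n : ℕ, 1 ≤ n → AbelianWords.abelianComplexity ω n = 3 := by
  intro n hn
  rw [AbelianWords.abelianComplexity_eq_ncard]
  exact AbelianWords.ncard_range_eq_three hA (fun i j a => hbal.abs_count_sub_le n i j a)
    (fun a => AbelianWords.exists_count_window_ne hletters haper hbal hn a)
    (fun i => AbelianWords.sum_count_window ω i n)
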